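/- Let $M$ be a smooth manifold (Hausdorff, second countable, without boundary) of dimension $m$, and let $x:M\to\mathbb R^{m+p}$ be a smooth immersion with induced metric $g_x$, volume measure $dV_x$, second fundamental form $h$ and mean curvature vector $H=\operatorname{tr}_{g_x}h$. For $q\in M$ let $T_q^\perp M=(x_*T_qM)^\perp$, and let $(\cdot)^\perp$ denote orthogonal projection onto it. A normal vector field is a smooth map $\xi:M\to\mathbb R^{m+p}$ with $\xi(q)\in T^\perp_qM$ for all $q$; it is parallel if $(d\xi(v))^\perp=0$ for all tangent vectors $v$. The immersion $x$ is called a $\xi$-submanifold if $H+x^\perp=\xi$ for some parallel normal vector field $\xi$. For a smooth map $\xi:M\to\mathbb R^{m+p}$, an immersion $y:M\to\mathbb R^{m+p}$ and a measurable set $B\subseteq M$ put $$V_\xi(y;B)=\int_B e^{-\frac12|y-\xi|^2}\,dV_y,\qquad \bar V_\xi(y;B)=\int_B e^{-\frac12|y-\xi|^2+\frac12|\xi|^2}\,dV_y,$$ and $V_\xi(y)=V_\xi(y;M)$, $\bar V_\xi(y)=\bar V_\xi(y;M)$. A compact normal variation of $x$ is a smooth map $F:M\times(-\varepsilon,\varepsilon)\to\mathbb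 R^{m+p}$, $\varepsilon>0$, such that $F(\cdot,0)=x$, every $x_t=F(\cdot,t)$ is an immersion, the supports of the fields $\frac{\partial F}{\partial t}(\cdot,t)$, $|t|<\varepsilon$, all lie in one relatively compact open set, and $\frac{\partial F}{\partial t}(\cdot,0)$ is normal to $x$. Call $x$ a critical point of $V_\xi$ for all compact normal variations if, for every such $F$, $\frac{d}{dt}\big|_{t=0}V_\xi(x_t;B)=0$ (the derivative exists and is zero) for every measurable $B\subseteq M$ that contains all these supports and has $V_\xi(x;B)<\infty$ (thus for $B=M$ whenever $V_\xi(x)<\infty$, and for relatively compact $B$ in any case); critical points of $\bar V_\xi$ are defined in the same way. Then $x$ is a $\xi$-submanifold if and only if there exists a parallel normal vector field $\xi$ of $x$ such that $x$ is a critical point of both $V_\xi$ and $\bar V_\xi$ for all compact normal variations of $x$. -/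

import Mathlib

open MeasureTheory Set
open scoped Manifold ContDiff

namespace XiSub

noncomputable section

/-- Euclidean space `ℝⁿ` with its standard inner product. -/
abbrev Euc (n : ℕ) : Type := EuclideanSpace ℝ (Fin n)

section Geometry

variable (m : ℕ) {n : ℕ} {M : Type*} [TopologicalSpace M] [ChartedSpace (Euc m) M]

/-- The differential `x_* : T_qM → ℝⁿ` of a map `x : M → ℝⁿ` at `q`
(`T_qM` is identified with `ℝᵐ` by the preferred chart at `q`). -/
def differential (x : M → Euc n) (q : M) : Euc m →L[ℝ] Euc n :=
  mfderiv (𝓡 m) (𝓡 n) x q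

/-- Smooth immersions: smooth maps whose differential is injective at every point. -/
structure IsImmersion (x : M → Euc n) : Prop where
  smooth : ContMDiff (𝓡 m) (𝓡 n) ∞ x
  injective : ∀ q, Function.Injective (differential m x q)

/-- The normal space `T_q^⊥M = (x_*(T_qM))^⊥` of `x` at `q`. -/
def normalSpace (x : M → Euc n) (q : M) : Submodule ℝ (Euc n) :=
  (LinearMap.range (differential m x q).toLinearMap)ᗮ

/-- The normal component `v^⊥` at `q` of a vector `v` of the ambient space. -/
def normalPart (x : M → Euc n) (q : M) (v : Euc n) : Euc n :=
  (normalSpace m x q).orthogonalProjectionOnto v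

/-- `x` written in the preferred chart at `q` (meaningful on the target of that chart). -/
def localForm (x : M → Euc n) (q : M) : Euc m → Euc n :=
  fun u => x ((chartAt (Euc m) q).symm u)

/-- The `i`-th coordinate vector `∂/∂uⁱ` of `ℝᵐ`. -/
def coordVec {m : ℕ} (i : Fin m) : Euc m := EuclideanSpace.single i 1

/-- The matrix `g_ij = ⟨∂x/∂uⁱ, ∂x/∂uʲ⟩` of the induced metric in the preferred chart at `q`,
at the point of coordinates `u`. -/
def metricMatrix (x : M → Euc n) (q : M) (u : Euc m) : Matrix (Fin m) (Fin m) ℝ :=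
  Matrix.of fun i j =>
    inner ℝ (fderiv ℝ (localForm m x q) u (coordVec i)) (fderiv ℝ (localForm m x q) u (coordVec j))

/-- The components `h_ij = (∂²x/∂uⁱ∂uʲ)^⊥` at `q` of the second fundamental form, in the preferred
chart at `q`. -/
def secondFundamentalForm (x : M → Euc n) (q : M) (i j : Fin m) : Euc n :=
  normalPart m x q
    (fderiv ℝ (fderiv ℝ (localForm m x q)) (chartAt (Euc m) q q) (coordVec i) (coordVec j))

/-- The mean curvature vector `H = tr_g h = ∑ gⁱʲ h_ij` (not divided by `m`). -/
def meanCurvature (x : M → Euc n) (q : M) : Euc n :=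
  ∑ i : Fin m, ∑ j : Fin m,
    (metricMatrix m x q (chartAt (Euc m) q q))⁻¹ i j • secondFundamentalForm m x q i j

/-- `ξ ∈ Γ(T^⊥M)`: `ξ` is a smooth normal vector field of `x`. -/
structure IsNormalField (x ξ : M → Euc n) : Prop where
  smooth : ContMDiff (𝓡 m) (𝓡 n) ∞ ξ
  normal : ∀ q, ξ q ∈ normalSpace m x q

/-- A normal vector field `ξ` that is parallel for the normal connection
`D^⊥_v ξ = (dξ(v))^⊥`. -/
structure IsParallelNormalField (x ξ : M → Euc n) : Prop extends IsNormalField m x ξ where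
  parallel : ∀ q (v : Euc m), normalPart m x q (differential m ξ q v) = 0

/-- `x` is a `ξ`-submanifold: `H + x^⊥ = ξ` for some parallel normal vector field `ξ`. -/
def IsXiSubmanifold (x : M → Euc n) : Prop :=
  ∃ ξ : M → Euc n, IsParallelNormalField m x ξ ∧
    ∀ q, meanCurvature m x q + normalPart m x q (x q) = ξ q

/-- The velocity `∂F/∂t (q, t)`. -/
def velocity (F : M × ℝ → Euc n) (t : ℝ) (q : M) : Euc n :=
  deriv (fun s => F (q, s)) t

/-- The restriction of `F` to `M × (-ε, ε)` is a (smooth) variation of `x` through immersions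
`x_t = F(·, t)`. -/
structure IsVariation (x : M → Euc n) (ε : ℝ) (F : M × ℝ → Euc n) : Prop where
  pos : 0 < ε
  smooth : ContMDiffOn ((𝓡 m).prod 𝓘(ℝ, ℝ)) (𝓡 n) ∞ F (univ ×ˢ Ioo (-ε) ε)
  initial : ∀ q, F (q, 0) = x q
  immersion : ∀ t ∈ Ioo (-ε) ε, IsImmersion m fun q => F (q, t)

/-- A compact normal variation of `x`: the supports of all velocity fields `∂F/∂t (·, t)` lie in one
relatively compact open set, and the variation field at `t = 0` is normal. -/
structure IsCompactNormalVariation (x : M → Euc n) (ε : ℝ) (F : M × ℝ → Euc n) : Prop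
    extends IsVariation m x ε F where
  compact : ∃ B : Set M, IsOpen B ∧ IsCompact (closure B) ∧
    ∀ t ∈ Ioo (-ε) ε, tsupport (velocity F t) ⊆ B
  normal : ∀ q, velocity F 0 q ∈ normalSpace m x q

/-- The weight `e^{-f_x}`, `f_x = ½|x - ξ|²`. -/
def weight (ξ x : M → Euc n) (q : M) : ℝ :=
  Real.exp (-(‖x q - ξ q‖ ^ 2 / 2))

/-- The weight `e^{-f̄_x}`, `f̄_x = ½|x - ξ|² - ½|ξ|²`. -/
def weightBar (ξ x : M → Euc n) (q : M) : ℝ :=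
  Real.exp (-(‖x q - ξ q‖ ^ 2 / 2 - ‖ξ q‖ ^ 2 / 2))

variable [MeasurableSpace M]

/-- The measure `√det(g_ij) du¹⋯duᵐ` on the domain of the preferred chart at `q`,
extended by zero to `M`. -/
def chartVolume (x : M → Euc n) (q : M) : Measure M :=
  Measure.map (chartAt (Euc m) q).symm
    ((volume.restrict (chartAt (Euc m) q).target).withDensity
      fun u => ENNReal.ofReal (Real.sqrt (metricMatrix m x q u).det))

/-- The volume measure `dV_x` of the metric induced by `x`. The measures `√det(g_ij) du¹⋯duᵐ` of
the charts agree on overlaps of chart domains, so gluing them is taking their supremum in the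
lattice of measures. -/
def inducedVolume (x : M → Euc n) : Measure M :=
  ⨆ q : M, chartVolume m x q

/-- `V_ξ(x) = ∫ e^{-f_x} dV_x`, extended over the part `B` of `M`. -/
def V (ξ : M → Euc n) (B : Set M) (x : M → Euc n) : ℝ :=
  ∫ q in B, weight ξ x q ∂(inducedVolume m x)

/-- `V̄_ξ(x) = ∫ e^{-f̄_x} dV_x`, extended over the part `B` of `M`. -/
def VBar (ξ : M → Euc n) (B : Set M) (x : M → Euc n) : ℝ :=
  ∫ q in B, weightBar ξ x q ∂(inducedVolume m x)

/-- `x` is a critical point of `V_ξ` for all compact normal variations: `d/dt V_ξ(x_t) = 0` at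
`t = 0`. The integral is extended over any part `B` of `M` which contains the places where `F` moves
and on which it is finite for `x`. So `B = M` is included if `V_ξ(x) < ∞`, and every relatively
compact `B` is in any case; the change `V_ξ(x_t) - V_ξ(x)` does not depend on `B`. -/
def IsCriticalV (ξ x : M → Euc n) : Prop :=
  ∀ (ε : ℝ) (F : M × ℝ → Euc n), IsCompactNormalVariation m x ε F →
    ∀ B : Set M, MeasurableSet B → (∀ t ∈ Ioo (-ε) ε, tsupport (velocity F t) ⊆ B) →
      IntegrableOn (weight ξ x) B (inducedVolume m x) →
        HasDerivAt (fun t => V m ξ B fun q => F (q, t)) 0 0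

/-- `x` is a critical point of `V̄_ξ` for all compact normal variations, in the same sense. -/
def IsCriticalVBar (ξ x : M → Euc n) : Prop :=
  ∀ (ε : ℝ) (F : M × ℝ → Euc n), IsCompactNormalVariation m x ε F →
    ∀ B : Set M, MeasurableSet B → (∀ t ∈ Ioo (-ε) ε, tsupport (velocity F t) ⊆ B) →
      IntegrableOn (weightBar ξ x) B (inducedVolume m x) →
        HasDerivAt (fun t => VBar m ξ B fun q => F (q, t)) 0 0

end Geometry

end

end XiSub

namespace XiSub

/-! ### Determinants -/

section Determinants

variable {ι E : Type*} [Fintype ι] [DecidableEq ι] [NormedAddCommGroup E] [NormedSpace ℝ E]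

/-! The equivalence holds for each fixed `ξ`, and rests on a pointwise first variation formula. Let
`W` be the velocity of a normal variation at `t = 0`. Differentiating `⟨W, ∂_b x⟩ = 0` gives `∂_t
g_ij = -2⟨W, h_ij⟩`, so by Jacobi's formula the volume density changes at the rate `-⟨H, W⟩`. Since
`ξ` does not move with `t`, the Gaussian weight changes at the rate `-⟨x - ξ, W⟩ = -⟨x^⊥ - ξ, W⟩`.
Hence the weighted density has derivative `-⟨H + x^⊥ - ξ, W⟩ e^{-f}`
(`IsVariation.hasDerivAt_density`); as `W` has no tangential part, no divergence term appears and
nothing is integrated by parts.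

To integrate this, all measures `dV_{x_t}` are written as `√detRatio · dV_x`. The ratio of Gram
determinants is independent of the chart (`detRatio_eq`), and multiplication by a positive finite
density commutes with the supremum that glues the chart measures (`iSup_withDensity`). Dominated
convergence then gives `IsCompactNormalVariation.hasDerivAt_integral`, with a time-independent
factor `c`: `c = 1` gives `V_ξ` and `c = e^{|ξ|²/2}` gives `V̄_ξ`.

If `H + x^⊥ = ξ`, both derivatives vanish. Conversely, criticality of `V_ξ` already forces the
equation (`eq_of_isCriticalV`): were `Z = H + x^⊥ - ξ` nonzero at `q`, a bump function times a
smooth normal field having positive inner product with `Z` near `q` would generate a variation with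
nonzero derivative. -/

theorem contDiffOn_det {k : WithTop ℕ∞} {s : Set E} {A : E → Matrix ι ι ℝ}
    (hA : ∀ i j, ContDiffOn ℝ k (fun e => A e i j) s) :
    ContDiffOn ℝ k (fun e => (A e).det) s := by
  simp only [Matrix.det_apply']
  exact ContDiffOn.sum fun σ _ => contDiffOn_const.mul (contDiffOn_prod fun i _ => hA _ _)

theorem contDiffOn_adjugate {k : WithTop ℕ∞} {s : Set E} {A : E → Matrix ι ι ℝ}
    (hA : ∀ i j, ContDiffOn ℝ k (fun e => A e i j) s) (i j : ι) :
    ContDiffOn ℝ k (fun e => (A e).adjugate i j) s := by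
  simp only [Matrix.adjugate_apply]
  refine contDiffOn_det fun a b => ?_
  by_cases h : a = j
  · subst h
    simpa using contDiffOn_const
  · simpa [Matrix.updateRow_ne h] using hA a b

theorem differentiable_det :
    Differentiable ℝ (fun A : ι → ι → ℝ => (Matrix.of A).det) := by
  have h : ContDiffOn ℝ 1 (fun A : ι → ι → ℝ => (Matrix.of A).det) univ :=
    contDiffOn_det fun i j => by
      simp only [Matrix.of_apply]
      fun_prop
  exact (contDiffOn_univ.mp h).differentiable one_ne_zero

/-- Jacobi's formula. -/
theorem hasDerivAt_det {A : ℝ → Matrix ι ι ℝ} {A' : Matrix ι ι ℝ} {t : ℝ}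
    (hA : ∀ i j, HasDerivAt (fun s => A s i j) (A' i j) t) (h0 : IsUnit (A t).det) :
    HasDerivAt (fun s => (A s).det) ((A t).det * ((A t)⁻¹ * A').trace) t := by
  let f : (ι → ι → ℝ) → ℝ := fun B => (Matrix.of B).det
  have hf := (differentiable_det (A t)).hasFDerivAt
  -- Only the straight line `A t + s A'` has to be computed: the Fréchet derivative at `A t` gives
  -- the same value along every curve with velocity `A'`. On the line `det (A t)` factors out, and
  -- `det (1 + s B)` is a polynomial in `s` with linear coefficient `tr B`.
  have hline : HasDerivAt (fun s : ℝ => f (A t + s • A')) ((A t).det * ((A t)⁻¹ * A').trace) 0 := by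
    have h : ∀ s : ℝ, f (A t + s • A') =
        (A t).det * (1 + ((A t)⁻¹ * A').trace * s +
          (Matrix.det (1 + (Polynomial.X : Polynomial ℝ) •
            ((A t)⁻¹ * A').map Polynomial.C)).divX.divX.eval s * s ^ 2) := by
      intro s
      rw [← Matrix.det_one_add_smul, ← Matrix.det_mul, Matrix.mul_add, Matrix.mul_one,
        Matrix.mul_smul, Matrix.mul_nonsing_inv_cancel_left _ _ h0]
      rfl
    rw [funext h]
    generalize (Matrix.det (1 + (Polynomial.X : Polynomial ℝ) •
            ((A t)⁻¹ * A').map Polynomial.C)).divX.divX = p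
    have h1 : HasDerivAt (fun s : ℝ => 1 + ((A t)⁻¹ * A').trace * s + p.eval s * s ^ 2)
        (((A t)⁻¹ * A').trace) 0 := by
      have := (((hasDerivAt_id' (0 : ℝ)).const_mul ((A t)⁻¹ * A').trace).const_add 1).fun_add
        ((p.hasDerivAt 0).fun_mul ((hasDerivAt_id' (0 : ℝ)).fun_pow 2))
      simpa using this
    exact h1.const_mul _
  have hA' : HasDerivAt (fun s => (fun i j => A s i j : ι → ι → ℝ)) (fun i j => A' i j) t :=
    hasDerivAt_pi.2 fun i => hasDerivAt_pi.2 fun j => hA i j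
  have h1 := hf.comp_hasDerivAt t hA'
  have hl : HasDerivAt (fun s : ℝ => ((fun i j => A t i j + s • A' i j) : ι → ι → ℝ))
      (fun i j => A' i j) 0 :=
    hasDerivAt_pi.2 fun i => hasDerivAt_pi.2 fun j => by
      simpa using ((hasDerivAt_id (0 : ℝ)).mul_const (A' i j)).const_add (A t i j)
  have h2 := (show HasFDerivAt f (fderiv ℝ f (A t)) (fun i j => A t i j + (0 : ℝ) • A' i j) by
    simpa using hf).comp_hasDerivAt (0 : ℝ) hl
  have h3 := hline.unique h2
  rw [h3]
  exact h1

end Determinants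

/-! ### Gram determinants of linear maps -/

theorem sum_smul_coordVec {m : ℕ} (v : Euc m) : ∑ i, v i • coordVec i = v := by
  have := (EuclideanSpace.basisFun (Fin m) ℝ).sum_repr v
  simpa [coordVec] using this

/-- The Gram matrix of a linear map precomposed with `L`. -/
theorem det_gram_comp {m n : ℕ} (A : Euc m →L[ℝ] Euc n) (L : Euc m →L[ℝ] Euc m) :
    (Matrix.gram ℝ fun i => A (L (coordVec i))).det =
      L.det ^ 2 * (Matrix.gram ℝ fun i => A (coordVec i)).det := by
  let D : Matrix (Fin m) (Fin m) ℝ := Matrix.of fun k i => L (coordVec i) k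
  have hD : D.det = L.det := by
    rw [ContinuousLinearMap.det,
      ← LinearMap.det_toMatrix (EuclideanSpace.basisFun (Fin m) ℝ).toBasis]
    congr 1
  have h : (Matrix.gram ℝ fun i => A (L (coordVec i))) =
      D.transpose * (Matrix.gram ℝ fun i => A (coordVec i)) * D := by
    ext i j
    have e : ∀ i, A (L (coordVec i)) = ∑ k, D k i • A (coordVec k) := fun i => by
      conv_lhs => rw [← sum_smul_coordVec (L (coordVec i))]
      simp [D]
    simp only [Matrix.gram_apply, e, Matrix.mul_apply, Matrix.transpose_apply, sum_inner,
      inner_sum, inner_smul_left, inner_smul_right, Finset.sum_mul, Finset.mul_sum]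
    refine Finset.sum_congr rfl fun a _ => Finset.sum_congr rfl fun b _ => ?_
    simp; ring
  rw [h, Matrix.det_mul, Matrix.det_mul, Matrix.det_transpose, hD]
  ring

theorem det_gram_pos {m n : ℕ} {A : Euc m →L[ℝ] Euc n} (hA : Function.Injective A) :
    0 < (Matrix.gram ℝ fun i => A (coordVec i)).det := by
  refine (Matrix.posDef_gram_of_linearIndependent ?_).det_pos
  have h := (EuclideanSpace.basisFun (Fin m) ℝ).toBasis.linearIndependent
  have h2 := h.map' A.toLinearMap (LinearMap.ker_eq_bot.2 hA)
  have e : (⇑A.toLinearMap ∘ ⇑(EuclideanSpace.basisFun (Fin m) ℝ).toBasis) =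
      fun i => A (coordVec i) := by
    ext i : 1
    simp [coordVec]
  rw [← e]
  exact h2

/-- With `det_gram_pos` this turns injectivity of a differential into positivity of a continuous
function, hence into an open condition. -/
theorem injective_of_det_gram_ne_zero {m n : ℕ} {A : Euc m →L[ℝ] Euc n}
    (hA : (Matrix.gram ℝ fun i => A (coordVec i)).det ≠ 0) : Function.Injective A := by
  have h := Matrix.linearIndependent_of_det_gram_ne_zero hA
  refine (injective_iff_map_eq_zero A).2 fun v hv => ?_
  rw [← sum_smul_coordVec v, map_sum] at hv
  simp only [map_smul] at hv
  ext i
  exact Fintype.linearIndependent_iff.1 h v hv i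

/-! ### Immersions in charts -/

section Charts

variable {m n : ℕ} {M : Type*} [TopologicalSpace M] [ChartedSpace (Euc m) M]

theorem inner_normalPart {x : M → Euc n} {q : M} {v w : Euc n} (hw : w ∈ normalSpace m x q) :
    inner ℝ (normalPart m x q v) w = inner ℝ v w :=
  (normalSpace m x q).inner_orthogonalProjectionOnto_eq_of_mem_right ⟨w, hw⟩ v

theorem normalPart_mem (x : M → Euc n) (q : M) (v : Euc n) :
    normalPart m x q v ∈ normalSpace m x q :=
  Subtype.property _

theorem meanCurvature_mem (x : M → Euc n) (q : M) : meanCurvature m x q ∈ normalSpace m x q :=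
  Submodule.sum_mem _ fun _ _ => Submodule.sum_mem _ fun _ _ =>
    Submodule.smul_mem _ _ (normalPart_mem x q _)

theorem metricMatrix_eq_gram (x : M → Euc n) (q : M) (u : Euc m) :
    metricMatrix m x q u = Matrix.gram ℝ fun i => fderiv ℝ (localForm m x q) u (coordVec i) :=
  rfl

variable [IsManifold (𝓡 m) ∞ M]

theorem contDiffOn_localForm {x : M → Euc n} (hx : ContMDiff (𝓡 m) (𝓡 n) ∞ x) (q : M) :
    ContDiffOn ℝ ∞ (localForm m x q) (chartAt (Euc m) q).target :=
  contMDiffOn_iff_contDiffOn.1 (hx.comp_contMDiffOn (contMDiffOn_chart_symm (I := 𝓡 m) (x := q)))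

theorem differentiableAt_localForm {x : M → Euc n} (hx : ContMDiff (𝓡 m) (𝓡 n) ∞ x) {q : M}
    {u : Euc m} (hu : u ∈ (chartAt (Euc m) q).target) :
    DifferentiableAt ℝ (localForm m x q) u :=
  ((contDiffOn_localForm hx q).contDiffAt
    ((chartAt (Euc m) q).open_target.mem_nhds hu)).differentiableAt (by simp)

/-- The differential of `x`, read in the chart at `q`, is that in the preferred chart composed
with a bijection. -/
theorem exists_fderiv_localForm_eq {x : M → Euc n} (hx : ContMDiff (𝓡 m) (𝓡 n) ∞ x) {q : M}
    {u : Euc m} (hu : u ∈ (chartAt (Euc m) q).target) :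
    ∃ T : Euc m →L[ℝ] Euc m, Function.Bijective T ∧
      fderiv ℝ (localForm m x q) u =
        (differential m x ((chartAt (Euc m) q).symm u)).comp T := by
  have he := (mdifferentiable_chart (I := 𝓡 m) q).symm
  refine ⟨mfderiv (𝓡 m) (𝓡 m) (chartAt (Euc m) q).symm u, he.mfderiv_bijective hu, ?_⟩
  rw [← mfderiv_eq_fderiv]
  exact mfderiv_comp u (hx.mdifferentiable (by simp) _) (he.mdifferentiableAt hu)

theorem IsImmersion.injective_fderiv_localForm {x : M → Euc n} (hx : IsImmersion m x) {q : M}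
    {u : Euc m} (hu : u ∈ (chartAt (Euc m) q).target) :
    Function.Injective (fderiv ℝ (localForm m x q) u) := by
  obtain ⟨T, hT, h⟩ := exists_fderiv_localForm_eq hx.smooth hu
  rw [h]
  exact (hx.injective _).comp hT.1

theorem injective_differential {x : M → Euc n} (hx : ContMDiff (𝓡 m) (𝓡 n) ∞ x) {q : M}
    {u : Euc m} (hu : u ∈ (chartAt (Euc m) q).target)
    (h : Function.Injective (fderiv ℝ (localForm m x q) u)) :
    Function.Injective (differential m x ((chartAt (Euc m) q).symm u)) := by
  obtain ⟨T, hT, hT'⟩ := exists_fderiv_localForm_eq hx hu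
  rw [hT'] at h
  exact Function.Injective.of_comp_right (g := T) h hT.2

theorem mem_normalSpace_iff {x : M → Euc n} (hx : ContMDiff (𝓡 m) (𝓡 n) ∞ x) {q : M}
    {u : Euc m} (hu : u ∈ (chartAt (Euc m) q).target) {v : Euc n} :
    v ∈ normalSpace m x ((chartAt (Euc m) q).symm u) ↔
      ∀ i, inner ℝ v (fderiv ℝ (localForm m x q) u (coordVec i)) = 0 := by
  obtain ⟨T, hT, hT'⟩ := exists_fderiv_localForm_eq hx hu
  rw [normalSpace, Submodule.mem_orthogonal']
  constructor
  · intro h i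
    rw [hT']
    exact h _ ⟨_, rfl⟩
  · rintro h _ ⟨w, rfl⟩
    obtain ⟨w, rfl⟩ := hT.2 w
    have : differential m x ((chartAt (Euc m) q).symm u) (T w) =
        fderiv ℝ (localForm m x q) u w := by rw [hT']; rfl
    change inner ℝ v (differential m x ((chartAt (Euc m) q).symm u) (T w)) = 0
    rw [this, ← sum_smul_coordVec w]
    simp [inner_sum, inner_smul_right, h]

theorem IsImmersion.det_metricMatrix_pos {x : M → Euc n} (hx : IsImmersion m x) {q : M}
    {u : Euc m} (hu : u ∈ (chartAt (Euc m) q).target) : 0 < (metricMatrix m x q u).det :=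
  det_gram_pos (hx.injective_fderiv_localForm hu)

variable (m) in
/-- The change of coordinates from the chart at `q` to the chart at `p`. -/
def transition (q p : M) : Euc m → Euc m :=
  chartAt (Euc m) p ∘ (chartAt (Euc m) q).symm

theorem differentiableAt_transition {q p : M} {u : Euc m} (hu : u ∈ (chartAt (Euc m) q).target)
    (hp : (chartAt (Euc m) q).symm u ∈ (chartAt (Euc m) p).source) :
    DifferentiableAt ℝ (transition m q p) u :=
  mdifferentiableAt_iff_differentiableAt.1 <|
    ((mdifferentiable_chart (I := 𝓡 m) p).mdifferentiableAt hp).comp u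
      ((mdifferentiable_chart (I := 𝓡 m) q).symm.mdifferentiableAt hu)

/-- By the chain rule the two Gram matrices differ by congruence with the Jacobian matrix. The
squared factor is what makes `√det g du` invariant under change of variables. -/
theorem det_metricMatrix_transition {x : M → Euc n} (hx : ContMDiff (𝓡 m) (𝓡 n) ∞ x) {q p : M}
    {u : Euc m} (hu : u ∈ (chartAt (Euc m) q).target)
    (hp : (chartAt (Euc m) q).symm u ∈ (chartAt (Euc m) p).source) :
    (metricMatrix m x q u).det = (fderiv ℝ (transition m q p) u).det ^ 2 *
      (metricMatrix m x p (transition m q p u)).det := by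
  have htar : transition m q p u ∈ (chartAt (Euc m) p).target :=
    (chartAt (Euc m) p).map_source hp
  have hEq : localForm m x q =ᶠ[nhds u] localForm m x p ∘ transition m q p := by
    have hc := (chartAt (Euc m) q).symm.continuousAt hu
    filter_upwards [hc.preimage_mem_nhds ((chartAt (Euc m) p).open_source.mem_nhds hp)] with v hv
    simp only [localForm, transition, Function.comp_apply]
    rw [(chartAt (Euc m) p).left_inv hv]
  have h := hEq.fderiv_eq (𝕜 := ℝ)
  rw [fderiv_comp (𝕜 := ℝ) u (differentiableAt_localForm hx htar)
    (differentiableAt_transition hu hp)] at h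
  rw [metricMatrix_eq_gram, metricMatrix_eq_gram, h, ← det_gram_comp]
  rfl

variable (m) in
/-- The square of the density of `dV_y` with respect to `dV_x`. -/
noncomputable def detRatio (x y : M → Euc n) (p : M) : ℝ :=
  (metricMatrix m y p (chartAt (Euc m) p p)).det / (metricMatrix m x p (chartAt (Euc m) p p)).det

/-- The squared Jacobian of the chart change multiplies numerator and denominator alike and cancels.
Thus a ratio defined with a different chart at each point can be read in one fixed chart, where its
smoothness is visible. -/
theorem detRatio_eq {x y : M → Euc n} (hx : ContMDiff (𝓡 m) (𝓡 n) ∞ x)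
    (hy : ContMDiff (𝓡 m) (𝓡 n) ∞ y) {q : M} {u : Euc m} (hu : u ∈ (chartAt (Euc m) q).target) :
    detRatio m x y ((chartAt (Euc m) q).symm u) =
      (metricMatrix m y q u).det / (metricMatrix m x q u).det := by
  set p := (chartAt (Euc m) q).symm u with hp
  have hps : (chartAt (Euc m) q).symm u ∈ (chartAt (Euc m) p).source := mem_chart_source _ p
  have hpq : p ∈ (chartAt (Euc m) q).source := (chartAt (Euc m) q).map_target hu
  have ht : (chartAt (Euc m) p) p ∈ (chartAt (Euc m) p).target := mem_chart_target _ p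
  have hback : (chartAt (Euc m) p).symm (chartAt (Euc m) p p) ∈ (chartAt (Euc m) q).source := by
    rwa [(chartAt (Euc m) p).left_inv (mem_chart_source _ p)]
  have e1 : transition m q p u = chartAt (Euc m) p p := rfl
  -- The reverse transition is a left inverse near `u`, so the product of the two Jacobians is 1.
  have hD : (fderiv ℝ (transition m q p) u).det ≠ 0 := by
    have hc : fderiv ℝ (transition m p q) (chartAt (Euc m) p p) ∘L fderiv ℝ (transition m q p) u =
        ContinuousLinearMap.id ℝ _ := by
      rw [← e1, ← fderiv_comp u (differentiableAt_transition ht hback)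
        (differentiableAt_transition hu hps), ← fderiv_id (x := u)]
      refine Filter.EventuallyEq.fderiv_eq ?_
      have hcont := (chartAt (Euc m) q).symm.continuousAt hu
      filter_upwards [(chartAt (Euc m) q).open_target.mem_nhds hu,
        hcont.preimage_mem_nhds ((chartAt (Euc m) p).open_source.mem_nhds hps)] with v hv hv'
      simp only [transition, Function.comp_apply, id]
      rw [(chartAt (Euc m) p).left_inv hv', (chartAt (Euc m) q).right_inv hv]
    have := congrArg ContinuousLinearMap.det hc
    intro h0
    rw [ContinuousLinearMap.det, ContinuousLinearMap.toLinearMap_comp, LinearMap.det_comp] at this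
    rw [ContinuousLinearMap.det] at h0
    simp [h0, ContinuousLinearMap.det] at this
  rw [det_metricMatrix_transition hx hu hps, det_metricMatrix_transition hy hu hps,
    mul_div_mul_left _ _ (pow_ne_zero 2 hD), e1, detRatio]

theorem detRatio_pos {x y : M → Euc n} (hx : IsImmersion m x) (hy : IsImmersion m y) (p : M) :
    0 < detRatio m x y p :=
  div_pos (hy.det_metricMatrix_pos (mem_chart_target _ p))
    (hx.det_metricMatrix_pos (mem_chart_target _ p))

end Charts

/-! ### The induced volume -/

/-- As `f` is neither 0 nor `⊤`, multiplication by `f` is an order automorphism of the measures,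
with inverse multiplication by `f⁻¹`; order automorphisms preserve suprema. -/
theorem iSup_withDensity {ι α : Type*} [MeasurableSpace α] (μ : ι → Measure α)
    {f : α → ENNReal} (hf : Measurable f) (h0 : ∀ a, f a ≠ 0) (htop : ∀ a, f a ≠ ⊤) :
    (⨆ i, μ i).withDensity f = ⨆ i, (μ i).withDensity f := by
  have hmono : ∀ {μ ν : Measure α} (g : α → ENNReal), μ ≤ ν → μ.withDensity g ≤ ν.withDensity g :=
    fun {μ ν} g h => Measure.le_iff.2 fun s hs => by
      rw [withDensity_apply _ hs, withDensity_apply _ hs]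
      exact lintegral_mono' (Measure.restrict_mono le_rfl h) le_rfl
  have hinv : ∀ μ : Measure α, (μ.withDensity f).withDensity f⁻¹ = μ := fun μ =>
    withDensity_inv_same hf (.of_forall h0) (.of_forall htop)
  have hinv' : ∀ μ : Measure α, (μ.withDensity f⁻¹).withDensity f = μ := fun μ => by
    have := withDensity_inv_same (μ := μ) hf.inv
      (.of_forall fun a => by simpa using htop a) (.of_forall fun a => by simpa using h0 a)
    simpa using this
  refine le_antisymm ?_ (iSup_le fun i => hmono f (le_iSup μ i))
  rw [← hinv' (⨆ i, (μ i).withDensity f)]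
  refine hmono f (iSup_le fun i => ?_)
  rw [← hinv (μ i)]
  exact hmono _ (le_iSup (fun i => (μ i).withDensity f) i)

section Volume

variable {m n : ℕ} {M : Type*} [TopologicalSpace M] [ChartedSpace (Euc m) M]

theorem measurable_det_metricMatrix (x : M → Euc n) (q : M) :
    Measurable fun u => (metricMatrix m x q u).det := by
  simp only [Matrix.det_apply', metricMatrix, Matrix.of_apply]
  refine Finset.measurable_sum _ fun σ _ => measurable_const.mul ?_
  refine Finset.measurable_prod _ fun i _ => ?_
  exact (measurable_fderiv_apply_const ℝ _ _).inner (measurable_fderiv_apply_const ℝ _ _)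

theorem measurable_volumeDensity (x : M → Euc n) (q : M) :
    Measurable fun u => ENNReal.ofReal (Real.sqrt (metricMatrix m x q u).det) :=
  (measurable_det_metricMatrix x q).sqrt.ennreal_ofReal

variable [MeasurableSpace M] [BorelSpace M]

theorem aemeasurable_chart_symm (q : M) :
    AEMeasurable (chartAt (Euc m) q).symm (volume.restrict (chartAt (Euc m) q).target) :=
  (chartAt (Euc m) q).continuousOn_symm.aemeasurable (chartAt (Euc m) q).open_target.measurableSet

theorem measurableSet_chart_preimage (q : M) {A : Set M} (hA : MeasurableSet A) :
    MeasurableSet ((chartAt (Euc m) q).target ∩ (chartAt (Euc m) q).symm ⁻¹' A) := by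
  have h : Measurable ((chartAt (Euc m) q).target.domRestrict (chartAt (Euc m) q).symm) :=
    (continuousOn_iff_continuous_domRestrict.1 (chartAt (Euc m) q).continuousOn_symm).measurable
  have := (chartAt (Euc m) q).open_target.measurableSet.subtype_image (h hA)
  convert this using 1
  ext u
  simp [Set.domRestrict, and_comm]

theorem chartVolume_apply (x : M → Euc n) (q : M) {A : Set M} (hA : MeasurableSet A) :
    chartVolume m x q A = ∫⁻ u in (chartAt (Euc m) q).target ∩ (chartAt (Euc m) q).symm ⁻¹' A,
      ENNReal.ofReal (Real.sqrt (metricMatrix m x q u).det) := by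
  rw [chartVolume, Measure.map_apply_of_aemeasurable _ hA, withDensity_apply',
    Measure.restrict_restrict₀, inter_comm]
  · exact (aemeasurable_chart_symm q).nullMeasurableSet_preimage hA
  · exact (aemeasurable_chart_symm q).mono_ac (withDensity_absolutelyContinuous _ _)

theorem map_withDensity_comp {α β : Type*} [MeasurableSpace α] [MeasurableSpace β] {μ : Measure α}
    [SFinite μ] {f : α → β} (hf : AEMeasurable f μ) {J : β → ENNReal} (hJ : Measurable J) :
    (μ.withDensity (J ∘ f)).map f = (μ.map f).withDensity J := by
  ext A hA
  rw [Measure.map_apply_of_aemeasurable (hf.mono_ac (withDensity_absolutelyContinuous _ _)) hA,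
    withDensity_apply', withDensity_apply _ hA, ← lintegral_indicator hA,
    lintegral_map' (hJ.indicator hA).aemeasurable hf,
    ← lintegral_indicator₀ (hf.nullMeasurableSet_preimage hA)]
  rfl

variable [IsManifold (𝓡 m) ∞ M]

theorem chartVolume_eq_withDensity {x y : M → Euc n} (hx : IsImmersion m x)
    (hy : IsImmersion m y) (hJ : Measurable (detRatio m x y)) (q : M) :
    chartVolume m y q = (chartVolume m x q).withDensity
      fun p => ENNReal.ofReal (Real.sqrt (detRatio m x y p)) := by
  have hJ' : Measurable fun p => ENNReal.ofReal (Real.sqrt (detRatio m x y p)) :=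
    hJ.sqrt.ennreal_ofReal
  have hs := aemeasurable_chart_symm (m := m) q
  rw [chartVolume, chartVolume,
    ← map_withDensity_comp (hs.mono_ac (withDensity_absolutelyContinuous _ _)) hJ',
    ← withDensity_mul₀ (measurable_volumeDensity x q).aemeasurable (hJ'.comp_aemeasurable hs)]
  congr 1
  refine withDensity_congr_ae ((ae_restrict_iff' (chartAt (Euc m) q).open_target.measurableSet).2
    (.of_forall fun u hu => ?_))
  have hpos := hx.det_metricMatrix_pos hu
  simp only [Pi.mul_apply, Function.comp_apply]
  rw [detRatio_eq hx.smooth hy.smooth hu, ← ENNReal.ofReal_mul (Real.sqrt_nonneg _),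
    ← Real.sqrt_mul hpos.le, mul_div_cancel₀ _ hpos.ne']

theorem inducedVolume_eq_withDensity {x y : M → Euc n} (hx : IsImmersion m x)
    (hy : IsImmersion m y) (hJ : Measurable (detRatio m x y)) :
    inducedVolume m y = (inducedVolume m x).withDensity
      fun p => ENNReal.ofReal (Real.sqrt (detRatio m x y p)) := by
  rw [inducedVolume, inducedVolume, iSup_withDensity _ hJ.sqrt.ennreal_ofReal]
  · exact iSup_congr fun q => chartVolume_eq_withDensity hx hy hJ q
  · intro p
    simpa using detRatio_pos hx hy p
  · simp

/-- Change of variables along the transition map, which is injective on the part of the chart at `q`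
lying over `A`. Inside one chart domain no other chart measure is larger, so that single chart
controls the supremum. -/
theorem chartVolume_le {x : M → Euc n} (hx : ContMDiff (𝓡 m) (𝓡 n) ∞ x) (q p : M) {A : Set M}
    (hA : MeasurableSet A) (hAp : A ⊆ (chartAt (Euc m) p).source) :
    chartVolume m x q A ≤ chartVolume m x p A := by
  rw [chartVolume_apply x q hA, chartVolume_apply x p hA]
  set s := (chartAt (Euc m) q).target ∩ (chartAt (Euc m) q).symm ⁻¹' A with hs
  have hsm : MeasurableSet s := measurableSet_chart_preimage q hA
  have hinj : InjOn (transition m q p) s := by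
    intro u hu v hv h
    have := (chartAt (Euc m) p).injOn (hAp hu.2) (hAp hv.2) h
    exact (chartAt (Euc m) q).symm.injOn hu.1 hv.1 this
  have hd : ∀ u ∈ s, HasFDerivWithinAt (transition m q p) (fderiv ℝ (transition m q p) u) s u :=
    fun u hu => (differentiableAt_transition hu.1 (hAp hu.2)).hasFDerivAt.hasFDerivWithinAt
  have hcv := lintegral_image_eq_lintegral_abs_det_fderiv_mul volume hsm hd hinj
    fun u => ENNReal.ofReal (Real.sqrt (metricMatrix m x p u).det)
  have himg : transition m q p '' s ⊆
      (chartAt (Euc m) p).target ∩ (chartAt (Euc m) p).symm ⁻¹' A := by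
    rintro _ ⟨u, hu, rfl⟩
    refine ⟨(chartAt (Euc m) p).map_source (hAp hu.2), ?_⟩
    simp only [transition, Function.comp_apply, mem_preimage]
    rw [(chartAt (Euc m) p).left_inv (hAp hu.2)]
    exact hu.2
  refine le_trans (le_of_eq ?_) (lintegral_mono_set himg)
  rw [hcv]
  refine setLIntegral_congr_fun hsm fun u hu => ?_
  rw [det_metricMatrix_transition hx hu.1 (hAp hu.2), Real.sqrt_mul (sq_nonneg _),
    Real.sqrt_sq_eq_abs, ENNReal.ofReal_mul (abs_nonneg _)]

theorem inducedVolume_le_chartVolume {x : M → Euc n} (hx : ContMDiff (𝓡 m) (𝓡 n) ∞ x) (p : M)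
    {A : Set M} (hA : MeasurableSet A) (hAp : A ⊆ (chartAt (Euc m) p).source) :
    inducedVolume m x A ≤ chartVolume m x p A := by
  set S := (chartAt (Euc m) p).source with hS
  have hSm : MeasurableSet S := (chartAt (Euc m) p).open_source.measurableSet
  -- A supremum of measures is bounded through a majorant that is itself a measure. Outside `S` the
  -- crude choice `⊤` does no harm, because `A` lies in `S`.
  have h : inducedVolume m x ≤ (chartVolume m x p).restrict S + (⊤ : Measure M).restrict Sᶜ := by
    refine iSup_le fun q => ?_
    rw [← Measure.restrict_add_restrict_compl (μ := chartVolume m x q) hSm]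
    refine add_le_add ?_ (Measure.restrict_mono le_rfl le_top)
    refine Measure.le_iff.2 fun B hB => ?_
    rw [Measure.restrict_apply hB, Measure.restrict_apply hB]
    exact chartVolume_le hx q p (hB.inter hSm) inter_subset_right
  refine (h A).trans ?_
  rw [Measure.add_apply, Measure.restrict_apply hA, Measure.restrict_apply hA,
    inter_eq_left.2 hAp, ← sdiff_eq, sdiff_eq_empty.2 hAp]
  simp

theorem isLocallyFiniteMeasure_inducedVolume {x : M → Euc n}
    (hx : ContMDiff (𝓡 m) (𝓡 n) ∞ x) : IsLocallyFiniteMeasure (inducedVolume m x) := by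
  refine ⟨fun p => ?_⟩
  set e := chartAt (Euc m) p with he
  have hcont : ContinuousOn (fun u => (metricMatrix m x p u).det) e.target := by
    refine (contDiffOn_det (k := ∞) fun i j => ?_).continuousOn
    have h := ((contDiffOn_localForm hx p).fderiv_of_isOpen e.open_target (m := ∞) le_rfl)
    exact (h.clm_apply contDiffOn_const).inner ℝ (h.clm_apply contDiffOn_const)
  have hep : e p ∈ e.target := mem_chart_target _ p
  have hca := (hcont.continuousAt (e.open_target.mem_nhds hep)).sqrt
  -- On this ball the density stays below its value at the centre plus 1.
  obtain ⟨r, hr, hball⟩ := Metric.mem_nhds_iff.1 (Filter.inter_mem (e.open_target.mem_nhds hep)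
    (hca (Iio_mem_nhds (lt_add_one _))))
  set U := e.source ∩ e ⁻¹' Metric.ball (e p) r with hU
  have hUo : IsOpen U := e.isOpen_inter_preimage Metric.isOpen_ball
  refine ⟨U, hUo.mem_nhds ⟨mem_chart_source _ p, Metric.mem_ball_self hr⟩, ?_⟩
  refine (inducedVolume_le_chartVolume hx p hUo.measurableSet inter_subset_left).trans_lt ?_
  rw [chartVolume_apply x p hUo.measurableSet]
  have hsub : e.target ∩ e.symm ⁻¹' U ⊆ Metric.ball (e p) r := by
    rintro u ⟨hu, hu'⟩
    have := hu'.2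
    rwa [mem_preimage, e.right_inv hu] at this
  refine (lintegral_mono_set hsub).trans_lt ?_
  refine setLIntegral_lt_top_of_le_nnreal measure_ball_lt_top.ne
    ⟨(Real.sqrt (metricMatrix m x p (e p)).det + 1).toNNReal, fun u hu => ?_⟩
  exact ENNReal.ofReal_le_ofReal (hball hu).2.le

theorem IsImmersion.isOpenPosMeasure_inducedVolume {x : M → Euc n} (hx : IsImmersion m x) :
    (inducedVolume m x).IsOpenPosMeasure := by
  refine ⟨fun U hU ⟨p, hp⟩ h0 => ?_⟩
  have hle : chartVolume m x p U ≤ inducedVolume m x U := le_iSup (chartVolume m x) p U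
  rw [h0, chartVolume_apply x p hU.measurableSet, nonpos_iff_eq_zero,
    setLIntegral_eq_zero_iff (measurableSet_chart_preimage p hU.measurableSet)
      (measurable_volumeDensity x p)] at hle
  have hopen := (chartAt (Euc m) p).symm.isOpen_inter_preimage hU
  have hne : ((chartAt (Euc m) p).target ∩ (chartAt (Euc m) p).symm ⁻¹' U).Nonempty :=
    ⟨_, mem_chart_target _ p, by
      rwa [mem_preimage, (chartAt (Euc m) p).left_inv (mem_chart_source _ p)]⟩
  refine (hopen.measure_pos volume hne).ne' ?_
  refine measure_mono_null (fun u hu => ?_) (ae_iff.1 hle)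
  intro h
  have := h hu
  simp only [ENNReal.ofReal_eq_zero] at this
  exact (Real.sqrt_pos.2 (hx.det_metricMatrix_pos hu.1)).not_ge this

end Volume

/-! ### Time-dependent functions in charts -/

section TimeDependent

variable {m : ℕ} {M : Type*} [TopologicalSpace M] [ChartedSpace (Euc m) M]
  {E : Type*} [NormedAddCommGroup E] [NormedSpace ℝ E]

variable (m) in
/-- `Ψ` is smooth on `M × I`, read in the preferred charts of `M`. -/
def ChartSmooth (I : Set ℝ) (Ψ : M × ℝ → E) : Prop :=
  ∀ q : M, ContDiffOn ℝ ∞ (fun z : Euc m × ℝ => Ψ ((chartAt (Euc m) q).symm z.1, z.2))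
    ((chartAt (Euc m) q).target ×ˢ I)

variable {I : Set ℝ} {Ψ : M × ℝ → E}

theorem ChartSmooth.continuousOn (h : ChartSmooth m I Ψ) (hI : IsOpen I) :
    ContinuousOn Ψ (univ ×ˢ I) := by
  rintro ⟨p, t⟩ ⟨-, ht⟩
  refine ContinuousAt.continuousWithinAt ?_
  set e := chartAt (Euc m) p with he
  have hmem : (e p, t) ∈ e.target ×ˢ I := ⟨mem_chart_target _ p, ht⟩
  have h1 := (h p).continuousOn.continuousAt ((e.open_target.prod hI).mem_nhds hmem)
  have h2 : ContinuousAt (fun z : M × ℝ => (e z.1, z.2)) (p, t) :=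
    ((e.continuousAt (mem_chart_source _ p)).comp continuousAt_fst).prodMk continuousAt_snd
  have h3 := ContinuousAt.comp (x := (p, t)) (f := fun z : M × ℝ => (e z.1, z.2)) h1 h2
  refine h3.congr ?_
  filter_upwards [(e.open_source.prod isOpen_univ).mem_nhds
    (show (p, t) ∈ e.source ×ˢ univ from ⟨mem_chart_source _ p, mem_univ _⟩)] with z hz
  simp only [Function.comp_apply]
  rw [e.left_inv hz.1]

theorem ChartSmooth.hasDerivAt_symm (h : ChartSmooth m I Ψ) (hI : IsOpen I) {q : M} {u : Euc m}
    (hu : u ∈ (chartAt (Euc m) q).target) {t : ℝ} (ht : t ∈ I) :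
    HasDerivAt (fun s => Ψ ((chartAt (Euc m) q).symm u, s))
      (fderiv ℝ (fun z : Euc m × ℝ => Ψ ((chartAt (Euc m) q).symm z.1, z.2)) (u, t) (0, 1)) t := by
  have h1 := (((h q).contDiffAt (((chartAt (Euc m) q).open_target.prod hI).mem_nhds
    (show (u, t) ∈ _ from ⟨hu, ht⟩))).differentiableAt (by simp)).hasFDerivAt
  exact h1.comp_hasDerivAt t ((hasDerivAt_const t u).prodMk (hasDerivAt_id t))

theorem ChartSmooth.differentiableAt (h : ChartSmooth m I Ψ) (hI : IsOpen I) (p : M) {t : ℝ}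
    (ht : t ∈ I) : DifferentiableAt ℝ (fun s => Ψ (p, s)) t := by
  have := (h.hasDerivAt_symm hI (mem_chart_target _ p) ht).differentiableAt
  rwa [(chartAt (Euc m) p).left_inv (mem_chart_source _ p)] at this

theorem ChartSmooth.deriv (h : ChartSmooth m I Ψ) (hI : IsOpen I) :
    ChartSmooth m I fun z : M × ℝ => deriv (fun s => Ψ (z.1, s)) z.2 := by
  intro q
  have h1 := (h q).fderiv_of_isOpen ((chartAt (Euc m) q).open_target.prod hI) (m := ∞) le_rfl
  refine (h1.clm_apply (contDiffOn_const (c := ((0 : Euc m), (1 : ℝ))))).congr fun z hz => ?_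
  exact (h.hasDerivAt_symm hI hz.1 hz.2).deriv

end TimeDependent

/-! ### Variations -/

section Variation

variable {m n : ℕ} {M : Type*} [TopologicalSpace M] [ChartedSpace (Euc m) M]
  {x ξ : M → Euc n} {ε : ℝ} {F : M × ℝ → Euc n}

theorem ChartSmooth.fderiv_localForm {I : Set ℝ} (h : ChartSmooth m I F) (hI : IsOpen I) {q : M}
    {u : Euc m} (hu : u ∈ (chartAt (Euc m) q).target) {t : ℝ} (ht : t ∈ I) (v : Euc m) :
    fderiv ℝ (localForm m (fun p => F (p, t)) q) u v =
      fderiv ℝ (fun z : Euc m × ℝ => F ((chartAt (Euc m) q).symm z.1, z.2)) (u, t) (v, 0) := by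
  have h1 := (((h q).contDiffAt (((chartAt (Euc m) q).open_target.prod hI).mem_nhds
    (show (u, t) ∈ _ from ⟨hu, ht⟩))).differentiableAt (by simp)).hasFDerivAt
  have h2 := HasFDerivAt.comp (f := fun v : Euc m => (v, t)) u h1 (hasFDerivAt_prodMk_left u t)
  have h3 : HasFDerivAt (localForm m (fun p => F (p, t)) q) _ u := h2
  rw [h3.fderiv]
  simp

theorem ChartSmooth.contDiffOn_metricMatrix {I : Set ℝ} (h : ChartSmooth m I F) (hI : IsOpen I)
    (q : M) (i j : Fin m) :
    ContDiffOn ℝ ∞ (fun z : Euc m × ℝ => metricMatrix m (fun p => F (p, z.2)) q z.1 i j)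
      ((chartAt (Euc m) q).target ×ˢ I) := by
  have h1 := (h q).fderiv_of_isOpen ((chartAt (Euc m) q).open_target.prod hI) (m := ∞) le_rfl
  refine ((h1.clm_apply (contDiffOn_const (c := (coordVec i, (0 : ℝ))))).inner ℝ
    (h1.clm_apply (contDiffOn_const (c := (coordVec j, (0 : ℝ)))))).congr fun z hz => ?_
  simp only [metricMatrix, Matrix.of_apply]
  rw [h.fderiv_localForm hI hz.1 hz.2, h.fderiv_localForm hI hz.1 hz.2]

theorem IsVariation.zero_mem (hF : IsVariation m x ε F) : (0 : ℝ) ∈ Ioo (-ε) ε :=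
  ⟨neg_lt_zero.2 hF.pos, hF.pos⟩

theorem IsVariation.initial_eq (hF : IsVariation m x ε F) : (fun p => F (p, 0)) = x :=
  funext hF.initial

variable [IsManifold (𝓡 m) ∞ M]

theorem chartSmooth_of_contMDiffOn {I : Set ℝ}
    (hF : ContMDiffOn ((𝓡 m).prod 𝓘(ℝ, ℝ)) (𝓡 n) ∞ F (univ ×ˢ I)) : ChartSmooth m I F := by
  intro q
  have h1 : ContMDiffOn ((𝓡 m).prod 𝓘(ℝ, ℝ)) ((𝓡 m).prod 𝓘(ℝ, ℝ)) ∞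
      (fun z : Euc m × ℝ => ((chartAt (Euc m) q).symm z.1, z.2))
      ((chartAt (Euc m) q).target ×ˢ I) :=
    ((contMDiffOn_chart_symm (I := 𝓡 m) (x := q)).comp contMDiffOn_fst fun z hz => hz.1).prodMk
      contMDiffOn_snd
  have h2 := hF.comp h1 fun z hz => ⟨mem_univ _, hz.2⟩
  rw [← contMDiffOn_iff_contDiffOn]
  rw [modelWithCornersSelf_prod, ← chartedSpaceSelf_prod]
  exact h2

theorem IsImmersion.contDiffOn_metricMatrix (hx : IsImmersion m x) (q : M) (i j : Fin m) :
    ContDiffOn ℝ ∞ (fun u => metricMatrix m x q u i j) (chartAt (Euc m) q).target := by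
  have h := (contDiffOn_localForm hx.smooth q).fderiv_of_isOpen
    (chartAt (Euc m) q).open_target (m := ∞) le_rfl
  exact (h.clm_apply contDiffOn_const).inner ℝ (h.clm_apply contDiffOn_const)

theorem chartSmooth_detRatio {I : Set ℝ} (hI : IsOpen I) (hx : IsImmersion m x)
    (hF : ContMDiffOn ((𝓡 m).prod 𝓘(ℝ, ℝ)) (𝓡 n) ∞ F (univ ×ˢ I)) :
    ChartSmooth m I fun z : M × ℝ => detRatio m x (fun p => F (p, z.2)) z.1 := by
  intro q
  have h1 := contDiffOn_det ((chartSmooth_of_contMDiffOn hF).contDiffOn_metricMatrix hI q)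
  have h2 : ContDiffOn ℝ ∞ (fun z : Euc m × ℝ => (metricMatrix m x q z.1).det)
      ((chartAt (Euc m) q).target ×ˢ I) :=
    (contDiffOn_det (hx.contDiffOn_metricMatrix q)).comp contDiffOn_fst fun z hz => hz.1
  refine (h1.div h2 fun z hz => (hx.det_metricMatrix_pos hz.1).ne').congr fun z hz => ?_
  have hs : ContMDiff (𝓡 m) (𝓡 n) ∞ fun p => F (p, z.2) :=
    hF.comp_contMDiff (contMDiff_id.prodMk contMDiff_const) fun p => ⟨mem_univ _, hz.2⟩
  exact detRatio_eq hx.smooth hs hz.1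

namespace IsVariation

variable (hF : IsVariation m x ε F)
include hF

theorem chartSmooth : ChartSmooth m (Ioo (-ε) ε) F := chartSmooth_of_contMDiffOn hF.smooth

theorem chartSmooth_sqrt_detRatio (hx : IsImmersion m x) :
    ChartSmooth m (Ioo (-ε) ε)
      fun z : M × ℝ => Real.sqrt (detRatio m x (fun p => F (p, z.2)) z.1) := fun q =>
  (chartSmooth_detRatio isOpen_Ioo hx hF.smooth q).sqrt fun _ hz =>
    (detRatio_pos hx (hF.immersion _ hz.2) _).ne'

theorem chartSmooth_weight (hξ : ContMDiff (𝓡 m) (𝓡 n) ∞ ξ) :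
    ChartSmooth m (Ioo (-ε) ε) fun z : M × ℝ => weight ξ (fun p => F (p, z.2)) z.1 := by
  intro q
  have h1 := hF.chartSmooth q
  have h2 : ContDiffOn ℝ ∞ (fun z : Euc m × ℝ => ξ ((chartAt (Euc m) q).symm z.1))
      ((chartAt (Euc m) q).target ×ˢ Ioo (-ε) ε) :=
    (contDiffOn_localForm hξ q).comp contDiffOn_fst fun z hz => hz.1
  exact (((h1.sub h2).norm_sq ℝ).div_const 2).neg.exp

/-- The integrand of `V_ξ(x_t)` with respect to `dV_x` is smooth. -/
theorem chartSmooth_density (hx : IsImmersion m x) (hξ : ContMDiff (𝓡 m) (𝓡 n) ∞ ξ) :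
    ChartSmooth m (Ioo (-ε) ε) fun z : M × ℝ =>
      Real.sqrt (detRatio m x (fun p => F (p, z.2)) z.1) *
        weight ξ (fun p => F (p, z.2)) z.1 :=
  fun q => (hF.chartSmooth_sqrt_detRatio hx q).mul (hF.chartSmooth_weight hξ q)

theorem hasDerivAt_velocity (p : M) :
    HasDerivAt (fun s => F (p, s)) (velocity F 0 p) 0 :=
  (hF.chartSmooth.differentiableAt isOpen_Ioo p hF.zero_mem).hasDerivAt

/-- For a normal variation, the metric satisfies `∂g_ij/∂t = -2⟨∂F/∂t, h_ij⟩` at `t = 0`. -/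
theorem hasDerivAt_metricMatrix (hx : IsImmersion m x)
    (hN : ∀ q, velocity F 0 q ∈ normalSpace m x q) (p : M) (i j : Fin m) :
    HasDerivAt (fun t => metricMatrix m (fun q => F (q, t)) p (chartAt (Euc m) p p) i j)
      (-2 * inner ℝ (velocity F 0 p) (secondFundamentalForm m x p i j)) 0 := by
  set e := chartAt (Euc m) p with he
  set u := e p with hu
  have hut : u ∈ e.target := mem_chart_target _ p
  have hep : e.symm u = p := e.left_inv (mem_chart_source _ p)
  have h0 := hF.zero_mem
  set X : Euc m × ℝ → Euc n := fun z => F (e.symm z.1, z.2) with hX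
  have hopen : IsOpen (e.target ×ˢ Ioo (-ε) ε) := e.open_target.prod isOpen_Ioo
  have hmem : (u, (0 : ℝ)) ∈ e.target ×ˢ Ioo (-ε) ε := ⟨hut, h0⟩
  have hXs : ContDiffAt ℝ ∞ X (u, 0) := (hF.chartSmooth p).contDiffAt (hopen.mem_nhds hmem)
  have hX' := (hXs.fderiv_right (m := ∞) le_rfl).differentiableAt (by simp)
  have hsymm : IsSymmSndFDerivAt ℝ X (u, 0) := hXs.isSymmSndFDerivAt <| by
    rw [minSmoothness_of_isRCLikeNormedField]
    exact WithTop.coe_le_coe.2 (le_top : (2 : ℕ∞) ≤ ⊤)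
  set D := fderiv ℝ (fderiv ℝ X) (u, 0) with hD
  have hvel : ∀ v ∈ e.target, velocity F 0 (e.symm v) = fderiv ℝ X (v, 0) (0, 1) := fun v hv =>
    (hF.chartSmooth.hasDerivAt_symm isOpen_Ioo hv h0).deriv
  have hloc : ∀ v ∈ e.target, ∀ w, fderiv ℝ (localForm m x p) v w = fderiv ℝ X (v, 0) (w, 0) :=
    fun v hv w => by
      have := hF.chartSmooth.fderiv_localForm isOpen_Ioo hv h0 w
      rwa [hF.initial_eq] at this
  have hcurve : HasFDerivAt (fun v : Euc m => fderiv ℝ X (v, 0))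
      (D.comp (ContinuousLinearMap.inl ℝ (Euc m) ℝ)) u :=
    hX'.hasFDerivAt.comp u ((hasFDerivAt_id u).prodMk (hasFDerivAt_const (0 : ℝ) u))
  have hconst : ∀ (w : Euc m × ℝ), HasFDerivAt (fun v : Euc m => fderiv ℝ X (v, 0) w)
      ((D.comp (ContinuousLinearMap.inl ℝ (Euc m) ℝ)).flip w) u := fun w => by
    have := hcurve.clm_apply (hasFDerivAt_const w u)
    simpa using this
  have hsnd : ∀ a b : Fin m, fderiv ℝ (fderiv ℝ (localForm m x p)) u (coordVec a) (coordVec b) =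
      D (coordVec a, 0) (coordVec b, 0) := fun a b => by
    have hd : DifferentiableAt ℝ (fderiv ℝ (localForm m x p)) u :=
      (((contDiffOn_localForm hx.smooth p).contDiffAt (e.open_target.mem_nhds hut)).fderiv_right
        (m := ∞) le_rfl).differentiableAt (by simp)
    have h1 := hd.hasFDerivAt.clm_apply (hasFDerivAt_const (coordVec b) u)
    have h2 := (hconst (coordVec b, 0)).congr_of_eventuallyEq
      (f₁ := fun v => fderiv ℝ (localForm m x p) v (coordVec b))
      (by filter_upwards [e.open_target.mem_nhds hut] with v hv using hloc v hv _)
    have h3 := congrArg (fun T : Euc m →L[ℝ] Euc n => T (coordVec a)) (h1.unique h2)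
    simpa using h3
  -- At `t = 0` the product `⟨∂_t F, ∂_b F⟩` vanishes on the whole chart target, so its derivative
  -- in direction `a` is 0. This trades `⟨∂_a ∂_t F, ∂_b F⟩` for `-⟨∂_t F, ∂_a ∂_b F⟩`, and the
  -- normal vector `∂_t F` sees only the normal part of the second derivative.
  have horth : ∀ a b : Fin m, inner ℝ (D (coordVec a, 0) (0, 1)) (fderiv ℝ X (u, 0) (coordVec b, 0))
      = -inner ℝ (velocity F 0 p) (secondFundamentalForm m x p a b) := fun a b => by
    have h1 := (hconst (0, 1)).inner ℝ (hconst (coordVec b, 0))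
    have hzero : (fun v => inner ℝ (fderiv ℝ X (v, 0) (0, 1)) (fderiv ℝ X (v, 0) (coordVec b, 0)))
        =ᶠ[nhds u] fun _ => (0 : ℝ) := by
      filter_upwards [e.open_target.mem_nhds hut] with v hv
      rw [← hvel v hv, ← hloc v hv]
      exact (mem_normalSpace_iff hx.smooth hv).1 (hN _) b
    have h2 : HasFDerivAt (fun v => inner ℝ (fderiv ℝ X (v, 0) (0, 1))
        (fderiv ℝ X (v, 0) (coordVec b, 0))) (0 : Euc m →L[ℝ] ℝ) u :=
      (hasFDerivAt_const (0 : ℝ) u).congr_of_eventuallyEq hzero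
    have h3 := congrArg (fun T : Euc m →L[ℝ] ℝ => T (coordVec a)) (h1.unique h2)
    simp [fderivInnerCLM_apply] at h3
    have h4 : inner ℝ (velocity F 0 p) (secondFundamentalForm m x p a b) =
        inner ℝ (fderiv ℝ X (u, 0) (0, 1)) (D (coordVec a, 0) (coordVec b, 0)) := by
      rw [secondFundamentalForm, real_inner_comm, inner_normalPart (hN p), real_inner_comm,
        ← hsnd, ← hvel u hut, hep]
    rw [h4]
    linarith
  -- Symmetry of the second derivative of `F` exchanges `∂_t` and `∂_a`.
  have htime : ∀ a : Fin m, HasDerivAt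
      (fun t => fderiv ℝ (localForm m (fun q => F (q, t)) p) u (coordVec a))
      (D (coordVec a, 0) (0, 1)) 0 := fun a => by
    have h1 : HasDerivAt (fun t : ℝ => fderiv ℝ X (u, t)) (D (0, 1)) 0 :=
      hX'.hasFDerivAt.comp_hasDerivAt (0 : ℝ)
        ((hasDerivAt_const (0 : ℝ) u).prodMk (hasDerivAt_id (0 : ℝ)))
    have h2 := h1.clm_apply (hasDerivAt_const (0 : ℝ) (coordVec a, (0 : ℝ)))
    rw [hsymm.eq]
    refine (show HasDerivAt (fun t : ℝ => fderiv ℝ X (u, t) (coordVec a, 0))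
      (D (0, 1) (coordVec a, 0)) 0 by simpa using h2).congr_of_eventuallyEq ?_
    filter_upwards [isOpen_Ioo.mem_nhds h0] with t ht
    exact hF.chartSmooth.fderiv_localForm isOpen_Ioo hut ht _
  have hfin := (htime i).inner ℝ (htime j)
  rw [hF.initial_eq, hloc u hut, hloc u hut, horth i j, real_inner_comm, horth j i] at hfin
  have hsf : secondFundamentalForm m x p j i = secondFundamentalForm m x p i j := by
    rw [secondFundamentalForm, secondFundamentalForm, hsnd, hsnd, hsymm.eq]
  rw [hsf] at hfin
  exact hfin.congr_deriv (by ring)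

/-- The pointwise first variation of the weighted volume density. -/
theorem hasDerivAt_density (hx : IsImmersion m x)
    (hN : ∀ q, velocity F 0 q ∈ normalSpace m x q) (ξ : M → Euc n) (p : M) :
    HasDerivAt (fun t => Real.sqrt (detRatio m x (fun q => F (q, t)) p) *
        weight ξ (fun q => F (q, t)) p)
      (-(weight ξ x p * inner ℝ (meanCurvature m x p + normalPart m x p (x p) - ξ p)
        (velocity F 0 p))) 0 := by
  have hpos := hx.det_metricMatrix_pos (mem_chart_target (Euc m) p)
  have hA := hasDerivAt_det (A := fun t => metricMatrix m (fun q => F (q, t)) p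
    (chartAt (Euc m) p p)) (A' := Matrix.of fun i j =>
      -2 * inner ℝ (velocity F 0 p) (secondFundamentalForm m x p i j))
    (hF.hasDerivAt_metricMatrix hx hN p) (by rw [hF.initial_eq]; exact hpos.ne'.isUnit)
  rw [hF.initial_eq] at hA
  have htr : ((metricMatrix m x p (chartAt (Euc m) p p))⁻¹ * Matrix.of fun i j =>
      -2 * inner ℝ (velocity F 0 p) (secondFundamentalForm m x p i j)).trace =
      -2 * inner ℝ (velocity F 0 p) (meanCurvature m x p) := by
    have hs : ∀ i j, (metricMatrix m x p (chartAt (Euc m) p p))⁻¹ i j =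
        (metricMatrix m x p (chartAt (Euc m) p p))⁻¹ j i := fun i j => by
      have h1 : (metricMatrix m x p (chartAt (Euc m) p p)).IsHermitian :=
        Matrix.isHermitian_gram ℝ _
      have := h1.inv.apply i j
      simpa using this.symm
    rw [meanCurvature, Matrix.trace]
    simp only [Matrix.diag_apply, Matrix.mul_apply, Matrix.of_apply, inner_sum, inner_smul_right,
      Finset.mul_sum]
    rw [Finset.sum_comm]
    refine Finset.sum_congr rfl fun i _ => Finset.sum_congr rfl fun j _ => ?_
    rw [hs j i]
    ring
  rw [htr] at hA
  have hr := (hA.div_const (metricMatrix m x p (chartAt (Euc m) p p)).det)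
  -- The ratio is 1 at `t = 0`, so the square root contributes the factor 1/2 that absorbs the 2 of
  -- the trace.
  have h1 : detRatio m x (fun q => F (q, 0)) p = 1 := by
    rw [hF.initial_eq, detRatio, div_self hpos.ne']
  have hr' : HasDerivAt (fun t => detRatio m x (fun q => F (q, t)) p) _ 0 := hr
  have hsq := hr'.sqrt (by rw [h1]; exact one_ne_zero)
  have hw : HasDerivAt (fun t => weight ξ (fun q => F (q, t)) p) _ 0 :=
    ((((hF.hasDerivAt_velocity p).sub_const (ξ p)).norm_sq).div_const 2).neg.exp
  refine (hsq.mul hw).congr_deriv ?_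
  rw [h1, hF.initial, hF.initial_eq]
  have hx' := inner_normalPart (v := x p) (hN p)
  rw [inner_sub_left (meanCurvature m x p + normalPart m x p (x p)), inner_add_left, hx',
    inner_sub_left, real_inner_comm (meanCurvature m x p)]
  simp only [weight, Real.sqrt_one, Pi.neg_apply, hF.initial]
  field_simp
  ring

end IsVariation

end Variation

/-! ### The first variation formula -/

theorem weight_pos {n : ℕ} {M : Type*} (ξ x : M → Euc n) (p : M) : 0 < weight ξ x p :=
  Real.exp_pos _

section FirstVariation

variable {m n : ℕ} {M : Type*} [TopologicalSpace M] [ChartedSpace (Euc m) M]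
  {x y ξ : M → Euc n} {ε : ℝ} {F : M × ℝ → Euc n}

theorem detRatio_congr {x' : M → Euc n} {p : M} (h : y =ᶠ[nhds p] x') :
    detRatio m x y p = detRatio m x x' p := by
  set e := chartAt (Euc m) p with he
  have hc : ContinuousAt e.symm (e p) := e.symm.continuousAt (mem_chart_target _ p)
  have hep : e.symm (e p) = p := e.left_inv (mem_chart_source _ p)
  have h1 : localForm m y p =ᶠ[nhds (e p)] localForm m x' p :=
    hc.eventually (p := fun q => y q = x' q) (by rwa [hep])
  have h2 := h1.fderiv_eq (𝕜 := ℝ)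
  simp only [detRatio, metricMatrix, ← he]
  rw [h2]

theorem IsVariation.eq_of_notMem_tsupport [IsManifold (𝓡 m) ∞ M] (hF : IsVariation m x ε F) {p : M}
    (hp : ∀ t ∈ Ioo (-ε) ε, p ∉ tsupport (velocity F t)) {t : ℝ} (ht : t ∈ Ioo (-ε) ε) :
    F (p, t) = x p := by
  rw [← hF.initial p]
  refine isOpen_Ioo.is_const_of_deriv_eq_zero (𝕜 := ℝ) (f := fun s => F (p, s)) isPreconnected_Ioo
    (fun s hs => (hF.chartSmooth.differentiableAt isOpen_Ioo p hs).differentiableWithinAt)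
    (fun s hs => ?_) ht hF.zero_mem
  exact image_eq_zero_of_notMem_tsupport (f := velocity F s) (hp s hs)

theorem continuous_weight (hξ : Continuous ξ) (hx : Continuous x) :
    Continuous (weight ξ x) := by
  unfold weight
  fun_prop

variable [IsManifold (𝓡 m) ∞ M]

/-- `H` is computed in a chart that changes with the point, so its continuity is not visible from
the definition. The expression is, however, minus the time derivative of a density that is smooth in
every chart. -/
theorem continuous_firstVariation (hF : IsVariation m x ε F) (hx : IsImmersion m x)
    (hN : ∀ q, velocity F 0 q ∈ normalSpace m x q) (hξ : ContMDiff (𝓡 m) (𝓡 n) ∞ ξ) :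
    Continuous fun p => weight ξ x p * inner ℝ
      (meanCurvature m x p + normalPart m x p (x p) - ξ p) (velocity F 0 p) := by
  have h := ((hF.chartSmooth_density hx hξ).deriv isOpen_Ioo).continuousOn isOpen_Ioo
  have h1 : Continuous fun p : M => _ := (h.comp_continuous (f := fun p : M => (p, (0 : ℝ)))
    (by fun_prop) fun p => ⟨mem_univ _, hF.zero_mem⟩)
  refine h1.neg.congr fun p => ?_
  exact neg_eq_iff_eq_neg.2 (hF.hasDerivAt_density hx hN ξ p).deriv

variable [MeasurableSpace M] [BorelSpace M]

/-- Integrability is required only at `t = 0`: after passing to the fixed measure `dV_x`, the time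
derivatives are dominated by a multiple of the initial integrand, uniformly for small `t`. -/
theorem IsCompactNormalVariation.hasDerivAt_integral (hF : IsCompactNormalVariation m x ε F)
    (hx : IsImmersion m x) (hξ : ContMDiff (𝓡 m) (𝓡 n) ∞ ξ) {c : M → ℝ} (hc : Continuous c)
    (hc0 : ∀ p, 0 ≤ c p) {B : Set M} (hB : MeasurableSet B)
    (hint : IntegrableOn (fun p => c p * weight ξ x p) B (inducedVolume m x)) :
    HasDerivAt (fun t => ∫ p in B, c p * weight ξ (fun q => F (q, t)) p
        ∂(inducedVolume m fun q => F (q, t)))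
      (∫ p in B, -(c p * (weight ξ x p * inner ℝ
        (meanCurvature m x p + normalPart m x p (x p) - ξ p) (velocity F 0 p)))
        ∂(inducedVolume m x)) 0 := by
  have hV := hF.toIsVariation
  obtain ⟨B₀, -, hK, hsupp⟩ := hF.compact
  set K := closure B₀ with hKdef
  set I := Ioo (-ε) ε with hI
  have hIo : IsOpen I := isOpen_Ioo
  have h0 : (0 : ℝ) ∈ I := hV.zero_mem
  set Ψ : M × ℝ → ℝ := fun z => Real.sqrt (detRatio m x (fun p => F (p, z.2)) z.1) *
        weight ξ (fun p => F (p, z.2)) z.1 with hΨ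
  have hΨs : ChartSmooth m I Ψ := hV.chartSmooth_density hx hξ
  have hwc : Continuous (weight ξ x) := continuous_weight hξ.continuous hx.smooth.continuous
  -- continuity of slices of functions continuous on `M × I`
  have hslice : ∀ {Φ : M × ℝ → ℝ}, ContinuousOn Φ (univ ×ˢ I) → ∀ t ∈ I,
      Continuous fun p => Φ (p, t) := fun {Φ} h t ht =>
    h.comp_continuous (by fun_prop) fun p => ⟨mem_univ _, ht⟩
  -- change of measure
  have hR : ∀ t ∈ I, Measurable (detRatio m x fun q => F (q, t)) := fun t ht => by
    have h1 := (hslice ((hV.chartSmooth_sqrt_detRatio hx).continuousOn hIo) t ht).measurable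
    have h2 : detRatio m x (fun q => F (q, t)) =
        fun p => Real.sqrt (detRatio m x (fun q => F (q, t)) p) ^ 2 := by
      ext p
      rw [Real.sq_sqrt (detRatio_pos hx (hV.immersion t ht) p).le]
    rw [h2]
    exact h1.pow_const 2
  have hchange : ∀ t ∈ I, ∫ p in B, c p * weight ξ (fun q => F (q, t)) p
        ∂(inducedVolume m fun q => F (q, t)) = ∫ p in B, c p * Ψ (p, t) ∂(inducedVolume m x) := by
    intro t ht
    rw [inducedVolume_eq_withDensity hx (hV.immersion t ht) (hR t ht),
      setIntegral_withDensity_eq_setIntegral_toReal_smul (hR t ht).sqrt.ennreal_ofReal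
        (.of_forall fun _ => ENNReal.ofReal_lt_top) _ hB]
    refine integral_congr_ae (.of_forall fun p => ?_)
    simp only [ENNReal.toReal_ofReal (Real.sqrt_nonneg _), smul_eq_mul, hΨ]
    ring
  -- the time derivative vanishes outside `K` and is bounded by a multiple of the weight
  have hout : ∀ p ∉ K, ∀ t ∈ I, deriv (fun s => Ψ (p, s)) t = 0 := by
    intro p hp t ht
    have hev : ∀ s ∈ I, Ψ (p, s) = Ψ (p, 0) := by
      have : ∀ s ∈ I, Ψ (p, s) = Real.sqrt (detRatio m x x p) * weight ξ x p := fun s hs => by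
        have hs' : (fun q => F (q, s)) =ᶠ[nhds p] x := by
          filter_upwards [isClosed_closure.isOpen_compl.mem_nhds hp] with q hq
          exact hV.eq_of_notMem_tsupport
            (fun t ht hmem => hq (subset_closure (hsupp t ht hmem))) hs
        simp only [hΨ, weight]
        rw [detRatio_congr hs', hs'.eq_of_nhds]
      intro s hs
      rw [this s hs, this 0 h0]
    have : (fun s => Ψ (p, s)) =ᶠ[nhds t] fun _ => Ψ (p, 0) := by
      filter_upwards [hIo.mem_nhds ht] with s hs using hev s hs
    rw [this.deriv_eq, deriv_const]
  -- Halving the interval leaves a compact range of times inside `I`, so that continuity gives a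
  -- bound on `K` times that range.
  set S := Ioo (-(ε / 2)) (ε / 2) with hS
  have hε := hV.pos
  have hSI : Icc (-(ε / 2)) (ε / 2) ⊆ I := fun t ht => ⟨by linarith [ht.1], by linarith [ht.2]⟩
  have hdc := (hΨs.deriv hIo).continuousOn hIo
  obtain ⟨C, hC⟩ : ∃ C, ∀ z ∈ K ×ˢ Icc (-(ε / 2)) (ε / 2),
      ‖deriv (fun s => Ψ (z.1, s)) z.2 / weight ξ x z.1‖ ≤ C :=
    (hK.prod isCompact_Icc).exists_bound_of_continuousOn <|
      ((hdc.mono (prod_mono (subset_univ _) hSI)).div (hwc.comp continuous_fst).continuousOn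
        fun z _ => (weight_pos ξ x z.1).ne')
  have hbound : ∀ p, ∀ t ∈ S, ‖c p * deriv (fun s => Ψ (p, s)) t‖ ≤
      |C| * (c p * weight ξ x p) := by
    intro p t ht
    have hcw := mul_nonneg (hc0 p) (weight_pos ξ x p).le
    by_cases hp : p ∈ K
    · have h1 := (hC (p, t) ⟨hp, Ioo_subset_Icc_self ht⟩).trans (le_abs_self C)
      rw [norm_div, Real.norm_of_nonneg (weight_pos ξ x p).le, div_le_iff₀ (weight_pos ξ x p)] at h1
      rw [norm_mul, Real.norm_of_nonneg (hc0 p)]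
      calc _ ≤ c p * (|C| * weight ξ x p) := mul_le_mul_of_nonneg_left h1 (hc0 p)
        _ = _ := by ring
    · rw [hout p hp t (hSI (Ioo_subset_Icc_self ht)), mul_zero, norm_zero]
      positivity
  have hS0 : S ∈ nhds (0 : ℝ) := Ioo_mem_nhds (by linarith) (by linarith)
  have hmain := hasDerivAt_integral_of_dominated_loc_of_deriv_le
    (μ := (inducedVolume m x).restrict B) (F := fun t p => c p * Ψ (p, t))
    (F' := fun t p => c p * deriv (fun s => Ψ (p, s)) t) (x₀ := (0 : ℝ))
    (bound := fun p => |C| * (c p * weight ξ x p)) hS0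
    (by
      filter_upwards [hIo.mem_nhds h0] with t ht
      exact (hc.mul (hslice (hΨs.continuousOn hIo) t ht)).aestronglyMeasurable)
    (by
      have : (fun p => c p * Ψ (p, 0)) = fun p => c p * weight ξ x p := by
        ext p
        have h1 : detRatio m x x p = 1 :=
          div_self (hx.det_metricMatrix_pos (mem_chart_target (Euc m) p)).ne'
        simp only [hΨ]
        rw [hV.initial_eq, h1, Real.sqrt_one, one_mul]
      rw [this]
      exact hint)
    ((hc.mul (hslice hdc 0 h0)).aestronglyMeasurable)
    (.of_forall hbound) (hint.const_mul _)
    (.of_forall fun p t ht =>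
      (hΨs.differentiableAt hIo p (hSI (Ioo_subset_Icc_self ht))).hasDerivAt.const_mul _)
  have hd : ∀ p, deriv (fun s => Ψ (p, s)) 0 = -(weight ξ x p * inner ℝ
      (meanCurvature m x p + normalPart m x p (x p) - ξ p) (velocity F 0 p)) :=
    fun p => (hV.hasDerivAt_density hx hF.normal ξ p).deriv
  refine (hmain.2.congr_of_eventuallyEq ?_).congr_deriv ?_
  · filter_upwards [hIo.mem_nhds h0] with t ht using hchange t ht
  · exact integral_congr_ae (.of_forall fun p => by simp only [hd, mul_neg])

theorem isCritical_of_eq (hx : IsImmersion m x) (hξ : ContMDiff (𝓡 m) (𝓡 n) ∞ ξ)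
    (h : ∀ q, meanCurvature m x q + normalPart m x q (x q) = ξ q) :
    IsCriticalV m ξ x ∧ IsCriticalVBar m ξ x := by
  constructor
  · intro ε F hF B hB _ hint
    have := hF.hasDerivAt_integral hx hξ (c := fun _ => 1) continuous_const (fun _ => zero_le_one)
      hB (by simpa using hint)
    simpa [h, V] using this
  · intro ε F hF B hB _ hint
    have he : ∀ (y : M → Euc n) p, weightBar ξ y p = Real.exp (‖ξ p‖ ^ 2 / 2) * weight ξ y p :=
      fun y p => by
        rw [weightBar, weight, ← Real.exp_add]
        congr 1
        ring
    have hξc := hξ.continuous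
    have := hF.hasDerivAt_integral hx hξ (c := fun p => Real.exp (‖ξ p‖ ^ 2 / 2)) (by fun_prop)
      (fun _ => (Real.exp_pos _).le) hB (by simpa only [← he] using hint)
    simpa [h, VBar, ← he] using this

end FirstVariation

/-! ### Linear variations and critical points -/

theorem velocity_linear {n : ℕ} {M : Type*} (x η : M → Euc n) (t : ℝ) :
    velocity (fun z : M × ℝ => x z.1 + z.2 • η z.1) t = η := by
  ext1 q
  have h := ((hasDerivAt_id' t).smul_const (η q)).const_add (x q)
  rw [one_smul] at h
  exact h.deriv

section Converse

variable {m n : ℕ} {M : Type*} [TopologicalSpace M] [ChartedSpace (Euc m) M]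
  {x ξ η : M → Euc n}

theorem isImmersion_of_detRatio_pos [IsManifold (𝓡 m) ∞ M]
    {y : M → Euc n} (hy : ContMDiff (𝓡 m) (𝓡 n) ∞ y) (h : ∀ p, 0 < detRatio m x y p) :
    IsImmersion m y := by
  refine ⟨hy, fun p => ?_⟩
  have hne : (metricMatrix m y p (chartAt (Euc m) p p)).det ≠ 0 := fun h0 => by
    have := h p
    rw [detRatio, h0, zero_div] at this
    exact this.false
  have := injective_differential hy (mem_chart_target (Euc m) p)
    (injective_of_det_gram_ne_zero hne)
  rwa [(chartAt (Euc m) p).left_inv (mem_chart_source _ p)] at this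

/-- A compactly supported normal field generates a compact normal variation. -/
theorem exists_isCompactNormalVariation [T2Space M] [IsManifold (𝓡 m) ∞ M] (hx : IsImmersion m x)
    (hη : ContMDiff (𝓡 m) (𝓡 n) ∞ η) (hηc : HasCompactSupport η)
    (hN : ∀ q, η q ∈ normalSpace m x q) :
    ∃ ε, IsCompactNormalVariation m x ε fun z : M × ℝ => x z.1 + z.2 • η z.1 := by
  set F : M × ℝ → Euc n := fun z => x z.1 + z.2 • η z.1 with hF
  have hFs : ContMDiff ((𝓡 m).prod 𝓘(ℝ, ℝ)) (𝓡 n) ∞ F :=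
    (hx.smooth.comp contMDiff_fst).add (contMDiff_snd.smul (hη.comp contMDiff_fst))
  have hR := (chartSmooth_detRatio isOpen_univ hx hFs.contMDiffOn).continuousOn isOpen_univ
  rw [univ_prod_univ, continuousOn_univ] at hR
  have hslice : ∀ t, ContMDiff (𝓡 m) (𝓡 n) ∞ fun p => F (p, t) := fun t =>
    hFs.comp (contMDiff_id.prodMk contMDiff_const)
  have hone : ∀ p, detRatio m x x p = 1 := fun p =>
    div_self (hx.det_metricMatrix_pos (mem_chart_target (Euc m) p)).ne'
  have hF0 : (fun p => F (p, 0)) = x := by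
    ext1 p
    simp [hF]
  -- The ratio is continuous in `(p, t)` and equals 1 at `t = 0`; compactness of the support of `η`
  -- yields one time interval on which it stays positive over that support. Off the support nothing
  -- moves.
  obtain ⟨U, T, -, hTo, hKU, hT, hUT⟩ := generalized_tube_lemma hηc
    (isCompact_singleton (x := (0 : ℝ))) (isOpen_lt continuous_const hR) (by
      rintro ⟨p, t⟩ ⟨-, ht⟩
      rw [mem_singleton_iff] at ht
      subst ht
      simp only [mem_ofPred_eq]
      rw [hF0, hone]
      exact one_pos)
  obtain ⟨ε, hε, hball⟩ := Metric.mem_nhds_iff.1 (hTo.mem_nhds (singleton_subset_iff.1 hT))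
  rw [Real.ball_eq_Ioo, zero_sub, zero_add] at hball
  have : LocallyCompactSpace M := ChartedSpace.locallyCompactSpace (Euc m) M
  obtain ⟨B, hB, hKB, hBc⟩ := exists_isOpen_superset_and_isCompact_closure hηc.isCompact
  refine ⟨ε, ⟨hε, hFs.contMDiffOn, fun q => congrFun hF0 q, fun t ht =>
    isImmersion_of_detRatio_pos (x := x) (hslice t) fun p => ?_⟩, ⟨B, hB, hBc, fun t _ => ?_⟩,
    fun q => ?_⟩
  · by_cases hp : p ∈ tsupport η
    · have h1 : (p, t) ∈ U ×ˢ T := mk_mem_prod (hKU hp) (hball ht)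
      simpa only [mem_ofPred_eq] using hUT h1
    · have h1 : (fun q => F (q, t)) =ᶠ[nhds p] x := by
        filter_upwards [(isClosed_tsupport η).isOpen_compl.mem_nhds hp] with q hq
        simp [hF, image_eq_zero_of_notMem_tsupport hq]
      rw [detRatio_congr h1, hone]
      exact one_pos
  · rw [hF, velocity_linear]
    exact hKB
  · rw [hF, velocity_linear]
    exact hN q

variable (m) in
/-- `det g` times the normal component of the constant vector `v`, in the chart at `q`. -/
noncomputable def chartNormalField (x : M → Euc n) (q : M) (v : Euc n) (u : Euc m) : Euc n :=
  (metricMatrix m x q u).det • v - ∑ i, ∑ j,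
    ((metricMatrix m x q u).adjugate i j *
      inner ℝ v (fderiv ℝ (localForm m x q) u (coordVec j))) •
        fderiv ℝ (localForm m x q) u (coordVec i)

/-- This is `g · adj g = det g · 1`. Scaling by `det g` replaces the inverse matrix by the adjugate,
so the field is polynomial in `v` and the first derivatives of `x`. -/
theorem inner_chartNormalField_coord (x : M → Euc n) (q : M) (v : Euc n) (u : Euc m) (k : Fin m) :
    inner ℝ (chartNormalField m x q v u) (fderiv ℝ (localForm m x q) u (coordVec k)) = 0 := by
  set g := metricMatrix m x q u with hg
  have hgs : ∀ i, inner ℝ (fderiv ℝ (localForm m x q) u (coordVec i))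
      (fderiv ℝ (localForm m x q) u (coordVec k)) = g k i := fun i => by
    rw [real_inner_comm]
    rfl
  have hadj : ∀ j, ∑ i, g k i * g.adjugate i j = if k = j then g.det else 0 := fun j => by
    have := congrFun (congrFun g.mul_adjugate k) j
    rw [Matrix.mul_apply] at this
    rw [this]
    simp [Matrix.one_apply]
  rw [chartNormalField, inner_sub_left, inner_smul_left, sum_inner]
  simp only [sum_inner, inner_smul_left, hgs]
  rw [Finset.sum_comm]
  have : ∀ j, ∑ i, (starRingEnd ℝ) (g.adjugate i j *
      inner ℝ v (fderiv ℝ (localForm m x q) u (coordVec j))) * g k i =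
      (if k = j then g.det else 0) *
        inner ℝ v (fderiv ℝ (localForm m x q) u (coordVec j)) := fun j => by
    rw [← hadj j, Finset.sum_mul]
    refine Finset.sum_congr rfl fun i _ => ?_
    simp only [conj_trivial]
    ring
  simp only [← hg, this]
  simp

variable [IsManifold (𝓡 m) ∞ M]

theorem IsImmersion.contMDiffOn_chartNormalField (hx : IsImmersion m x) (q : M) (v : Euc n) :
    ContMDiffOn (𝓡 m) (𝓡 n) ∞ (fun p => chartNormalField m x q v (chartAt (Euc m) q p))
      (chartAt (Euc m) q).source := by
  have hg := hx.contDiffOn_metricMatrix q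
  have h := (contDiffOn_localForm hx.smooth q).fderiv_of_isOpen
    (chartAt (Euc m) q).open_target (m := ∞) le_rfl
  have hd : ∀ i : Fin m, ContDiffOn ℝ ∞
      (fun u => fderiv ℝ (localForm m x q) u (coordVec i)) (chartAt (Euc m) q).target :=
    fun i => h.clm_apply contDiffOn_const
  have h1 : ContDiffOn ℝ ∞ (chartNormalField m x q v) (chartAt (Euc m) q).target :=
    ((contDiffOn_det hg).smul contDiffOn_const).sub <| ContDiffOn.sum fun i _ =>
      ContDiffOn.sum fun j _ =>
        ((contDiffOn_adjugate hg i j).mul (contDiffOn_const.inner ℝ (hd j))).smul (hd i)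
  exact h1.contMDiffOn.comp (contMDiffOn_chart (I := 𝓡 m) (x := q))
    fun p hp => (chartAt (Euc m) q).map_source hp

theorem chartNormalField_mem (hx : ContMDiff (𝓡 m) (𝓡 n) ∞ x) {q p : M} (v : Euc n)
    (hp : p ∈ (chartAt (Euc m) q).source) :
    chartNormalField m x q v (chartAt (Euc m) q p) ∈ normalSpace m x p := by
  have := (mem_normalSpace_iff hx ((chartAt (Euc m) q).map_source hp)).2
    (inner_chartNormalField_coord x q v (chartAt (Euc m) q p))
  rwa [(chartAt (Euc m) q).left_inv hp] at this

theorem inner_chartNormalField (hx : ContMDiff (𝓡 m) (𝓡 n) ∞ x) {q : M} {v : Euc n}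
    (hv : v ∈ normalSpace m x q) :
    inner ℝ v (chartNormalField m x q v (chartAt (Euc m) q q)) =
      (metricMatrix m x q (chartAt (Euc m) q q)).det * ‖v‖ ^ 2 := by
  have h := (mem_normalSpace_iff hx (mem_chart_target (Euc m) q) (v := v)).1
    (by rwa [(chartAt (Euc m) q).left_inv (mem_chart_source _ q)])
  simp [chartNormalField, inner_smul_right, h]

variable [T2Space M] [MeasurableSpace M] [BorelSpace M]

/-- The defect `Z` is not itself used as variation field, since its smoothness has not been
established. It is replaced by the normal projection of the constant vector `Z q`, scaled by `det
g`: smooth on the chart domain, and with positive inner product with `Z` at `q`. -/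
theorem eq_of_isCriticalV (hx : IsImmersion m x) (hξ : IsNormalField m x ξ)
    (hcrit : IsCriticalV m ξ x) (q : M) :
    meanCurvature m x q + normalPart m x q (x q) = ξ q := by
  by_contra hne
  set Z : M → Euc n := fun p => meanCurvature m x p + normalPart m x p (x p) - ξ p with hZ
  have hZ0 : Z q ≠ 0 := sub_ne_zero.2 hne
  have hZN : ∀ p, Z p ∈ normalSpace m x p := fun p =>
    Submodule.sub_mem _ (Submodule.add_mem _ (meanCurvature_mem x p) (normalPart_mem x p _))
      (hξ.normal p)
  set N : M → Euc n := fun p => chartNormalField m x q (Z q) (chartAt (Euc m) q p) with hNdef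
  have hNs := hx.contMDiffOn_chartNormalField q (Z q)
  have hpos : 0 < inner ℝ (Z q) (N q) := by
    rw [hNdef, inner_chartNormalField hx.smooth (hZN q)]
    exact mul_pos (hx.det_metricMatrix_pos (mem_chart_target _ q))
      (pow_pos (norm_pos_iff.2 hZ0) 2)
  have key : ∀ φ : SmoothBumpFunction (𝓡 m) q, ∃ ε,
      IsCompactNormalVariation m x ε fun z : M × ℝ => x z.1 + z.2 • (φ z.1 • N z.1) := by
    intro φ
    refine exists_isCompactNormalVariation hx (η := fun p => φ p • N p) (φ.contMDiff_smul hNs)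
      φ.hasCompactSupport.smul_right fun p => ?_
    by_cases hp : p ∈ (chartAt (Euc m) q).source
    · exact Submodule.smul_mem _ _ (chartNormalField_mem hx.smooth _ hp)
    · have : φ p = 0 := by
        by_contra h
        exact hp (φ.support_subset_source h)
      rw [this, zero_smul]
      exact Submodule.zero_mem _
  have hcont : ∀ φ : SmoothBumpFunction (𝓡 m) q,
      Continuous fun p => weight ξ x p * inner ℝ (Z p) (φ p • N p) := by
    intro φ
    obtain ⟨ε, hF⟩ := key φ
    have := continuous_firstVariation hF.toIsVariation hx hF.normal hξ.smooth
    rwa [velocity_linear x fun p => φ p • N p] at this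
  have hval : ∀ φ : SmoothBumpFunction (𝓡 m) q,
      0 < weight ξ x q * inner ℝ (Z q) (φ q • N q) := fun φ => by
    rw [φ.eq_one, one_smul]
    exact mul_pos (weight_pos ξ x q) hpos
  -- localize to where `⟨Z, N⟩` is positive
  let φ₁ : SmoothBumpFunction (𝓡 m) q := Classical.arbitrary _
  -- The field `N` is controlled only on the chart domain, so a first bump `φ₁` supplies a globally
  -- continuous function whose positivity set is an open neighbourhood of `q`; the second bump `φ`
  -- is supported there.
  obtain ⟨φ, -, hφ⟩ := (SmoothBumpFunction.nhds_basis_tsupport (I := 𝓡 m) q).mem_iff.1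
    ((isOpen_lt continuous_const (hcont φ₁)).mem_nhds (hval φ₁))
  have hZNpos : ∀ p ∈ tsupport φ, 0 < inner ℝ (Z p) (N p) := by
    intro p hp
    have h1 : 0 < weight ξ x p * inner ℝ (Z p) (φ₁ p • N p) := hφ hp
    rw [inner_smul_right] at h1
    exact pos_of_mul_pos_right (pos_of_mul_pos_right h1 (weight_pos ξ x p).le) φ₁.nonneg
  set G : M → ℝ := fun p => weight ξ x p * inner ℝ (Z p) (φ p • N p) with hG
  have hG0 : ∀ p ∉ tsupport φ, G p = 0 := fun p hp => by
    simp [hG, image_eq_zero_of_notMem_tsupport hp]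
  have hGnonneg : 0 ≤ G := fun p => by
    by_cases hp : p ∈ tsupport φ
    · simp only [hG, inner_smul_right]
      exact mul_nonneg (weight_pos ξ x p).le (mul_nonneg φ.nonneg (hZNpos p hp).le)
    · exact (hG0 p hp).ge
  have := isLocallyFiniteMeasure_inducedVolume (m := m) hx.smooth
  have := hx.isOpenPosMeasure_inducedVolume
  have hGint : 0 < ∫ p, G p ∂(inducedVolume m x) :=
    (hcont φ).integral_pos_of_hasCompactSupport_nonneg_nonzero
      (HasCompactSupport.intro φ.hasCompactSupport hG0) hGnonneg (hval φ).ne'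
  obtain ⟨ε, hF⟩ := key φ
  have hK : MeasurableSet (tsupport φ) := (isClosed_tsupport φ).measurableSet
  -- Taking the compact set `tsupport φ` as the region of integration makes the weight integrable
  -- even if `V_ξ(x)` is infinite.
  have hwint : IntegrableOn (weight ξ x) (tsupport φ) (inducedVolume m x) :=
    (continuous_weight hξ.smooth.continuous hx.smooth.continuous).continuousOn.integrableOn_compact
      φ.hasCompactSupport
  have hd0 := hcrit ε _ hF (tsupport φ) hK (fun t _ => by
    rw [velocity_linear x fun p => φ p • N p]
    exact tsupport_smul_subset_left _ _) hwint
  have hd1 := hF.hasDerivAt_integral hx hξ.smooth (c := fun _ => 1) continuous_const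
    (fun _ => zero_le_one) hK (by simpa using hwint)
  rw [velocity_linear x fun p => φ p • N p] at hd1
  simp only [one_mul] at hd1
  have h0 := hd0.unique hd1
  rw [integral_neg, eq_comm, neg_eq_zero] at h0
  have h1 : ∫ p in tsupport φ, G p ∂(inducedVolume m x) = ∫ p, G p ∂(inducedVolume m x) :=
    setIntegral_eq_integral_of_forall_compl_eq_zero hG0
  exact hGint.ne' (h1.symm.trans h0)

end Converse

end XiSub

theorem corollary4p1 {m p : ℕ} {M : Type*} [TopologicalSpace M] [T2Space M]
    [SecondCountableTopology M] [MeasurableSpace M] [BorelSpace M]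
    [ChartedSpace (XiSub.Euc m) M] [IsManifold (𝓡 m) ∞ M]
    (x : M → XiSub.Euc (m + p)) (hx : XiSub.IsImmersion m x) :
    XiSub.IsXiSubmanifold m x ↔
      ∃ ξ : M → XiSub.Euc (m + p), XiSub.IsParallelNormalField m x ξ ∧
        XiSub.IsCriticalV m ξ x ∧ XiSub.IsCriticalVBar m ξ x :=
  exists_congr fun _ => and_congr_right fun hξ =>
    ⟨fun h => XiSub.isCritical_of_eq hx hξ.smooth h,
      fun h => XiSub.eq_of_isCriticalV hx hξ.toIsNormalField h.1⟩
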